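/- **Setting.** Let $\mathbb G=(\mathbb V,\mathbb E)$ be a finite undirected graph of agents, $\mathcal N_i$ the set of neighbors of $i$ (with $i\notin\mathcal N_i$), and $\mathbb V=\mathcal L\sqcup\mathcal M$ a partition into legitimate and malicious agents such that the subgraph induced by $\mathcal L$ is connected (in particular $\mathcal L\neq\emptyset$). Let $\mathcal X\subset\mathbb R^d$ be nonempty, compact and convex, with Euclidean projection $\Pi_{\mathcal X}(y)=\operatorname{argmin}_{z\in\mathcal X}\|z-y\|$. For every $i\in\mathcal L$ let $f_i:\mathbb R^d\to\mathbb R$ be differentiable and $\mu$-strongly convex ($\mu>0$) with Lipschitz continuous gradient, with a common Lipschitz constant, and put $f_{\mathcal L}=\frac1{|\mathcal L|}\sum_{i\in\mathcal L}f_i$. Let $(\gamma(t))_{t\ge0}$ be nonnegative and nonincreasing with $\sum_t\gamma(t)=\infty$ and $\sum_t\gamma(t)^2<\infty$; put $\gamma(k)=0$ for $k<0$. **Trust observations.** On a probability space, for $i\in\mathcal L$, $j\in\mathcal N_i$ and $t\ge0$, let $\alpha_{ij}(t)$ be random variables with values in $[0,1]$ (almost surely) that are mutually independent over all such triples $(i,j,t)$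 and, for each fixed pair $(i,j)$, identically distributed in $t$. Suppose that there are scalars $E_{\mathcal L}>0$ and $E_{\mathcal M}<0$ such that $\mathbb E[\alpha_{ij}(t)]-\frac12$ equals $E_{\mathcal L}$ for $i\in\mathcal L$, $j\in\mathcal N_i\cap\mathcal L$, and equals $E_{\mathcal M}$ for $i\in\mathcal L$, $j\in\mathcal N_i\cap\mathcal M$. **Algorithm.** For $i\in\mathcal L$ and $j\in\mathcal N_i$ put $$\beta_{ij}(t)=\sum_{k=0}^{t-1}\bigl(\alpha_{ij}(k)-\tfrac12\bigr),\qquad \mathcal N_i(t)=\{j\in\mathcal N_i:\beta_{ij}(t)\ge0\},\qquad d_i(t)=|\mathcal N_i(t)|+1 .$$ At each time $t$, every legitimate agent $j$ sends $x_j(t)$ and $d_j(t)$ to its neighbors. A malicious agent $j$ sends to each legitimate neighbor $i$ an arbitrary point $x_{ji}(t)\in\mathcal X$ and an arbitrary real number $d_{ji}(t)$; these may depend on the receiver $i$, on the time and on the sample point (hence on everything that has happened). For $j\in\mathcal L$ write $x_{ji}(t)=x_j(t)$ and $d_{ji}(t)=d_j(t)$. Given an integer $T_0\ge0$, the weights of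 an agent $i\in\mathcal L$ are $$w_{ij}(t)=\frac{\mathbf 1_{\{t\ge T_0\}}}{2\max\{d_i(t),d_{ji}(t)\}}\ \text{ if } j\in\mathcal N_i(t),\qquad w_{ij}(t)=0\ \text{ if } j\notin\mathcal N_i(t)\cup\{i\},\qquad w_{ii}(t)=1-\sum_{m\in\mathcal N_i}w_{im}(t),$$ and, starting from arbitrary (possibly random) points $x_i(0)\in\mathcal X$, $i\in\mathcal L$, its iterates are $$c_i(t)=w_{ii}(t)x_i(t)+\sum_{j\in\mathcal N_i(t)}w_{ij}(t)\,x_{ji}(t),\qquad x_i(t+1)=\Pi_{\mathcal X}\bigl(c_i(t)-\gamma(t-T_0)\nabla f_i(c_i(t))\bigr).$$ **Theorem (convergence a.s. to the optimal point).** The function $f_{\mathcal L}$ has a unique minimizer $x^\star_{\mathcal L}$ over $\mathcal X$. For every $T_0\ge0$, all initial points, all malicious inputs as above and every $i\in\mathcal L$, the sequence $x_i(t)$ converges to $x^\star_{\mathcal L}$ almost surely as $t\to\infty$. -/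

import Mathlib

open MeasureTheory ProbabilityTheory Filter Topology

namespace TrustOpt

noncomputable section

/-- `IsProj X y p`: the point `p` is a minimizer of `z ↦ ‖z - y‖` over `X`. -/
def IsProj {d : ℕ} (X : Set (EuclideanSpace ℝ (Fin d))) (y p : EuclideanSpace ℝ (Fin d)) : Prop :=
  p ∈ X ∧ ∀ z ∈ X, ‖p - y‖ ≤ ‖z - y‖

/-- The Euclidean projection `Π_X(y) = argmin_{z ∈ X} ‖z - y‖` (see `proj_spec`). -/
def proj {d : ℕ} (X : Set (EuclideanSpace ℝ (Fin d))) (y : EuclideanSpace ℝ (Fin d)) :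
    EuclideanSpace ℝ (Fin d) :=
  Classical.epsilon (IsProj X y)

/-- For a nonempty compact set, `proj X y` is indeed a nearest point. -/
theorem proj_spec {d : ℕ} {X : Set (EuclideanSpace ℝ (Fin d))} (hX : IsCompact X)
    (hne : X.Nonempty) (y : EuclideanSpace ℝ (Fin d)) : IsProj X y (proj X y) := by
  have hc : ContinuousOn (fun z => ‖z - y‖) X := by fun_prop
  obtain ⟨p, hp, hmin⟩ := hX.exists_isMinOn hne hc
  exact Classical.epsilon_spec (p := IsProj X y) ⟨p, hp, fun z hz => hmin hz⟩

/-- The legitimate agents' average objective `f_L(x) = (1/|L|) ∑_{i ∈ L} f_i(x)`. -/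
def avgObjective {V : Type*} {d : ℕ} (L : Finset V) (f : V → EuclideanSpace ℝ (Fin d) → ℝ)
    (x : EuclideanSpace ℝ (Fin d)) : ℝ :=
  (1 / (L.card : ℝ)) * ∑ i ∈ L, f i x

/-- `β(t) = ∑_{k=0}^{t-1} (a(k) - 1/2)` for a realized sequence `a` of trust observations
(so that `β(0) = 0`). -/
def trustSum (a : ℕ → ℝ) (t : ℕ) : ℝ :=
  ∑ k ∈ Finset.range t, (a k - 1 / 2)

/- Below, `a i j t` is a realization of the trust observation `α_{ij}(t)`. -/

open Classical in
/-- The trusted neighborhood `N_i(t) = {j ∈ N_i : β_{ij}(t) ≥ 0}`. -/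
def trustedNbrs {V : Type*} [Fintype V] (G : SimpleGraph V) (a : V → V → ℕ → ℝ)
    (t : ℕ) (i : V) : Finset V :=
  Finset.univ.filter fun j => G.Adj i j ∧ 0 ≤ trustSum (a i j) t

open Classical in
/-- The value `d_j(t)` that agent `i` receives from agent `j` at time `t`: a legitimate agent `j`
sends `|N_j(t)| + 1`, a malicious agent `j` sends an arbitrary number `e j i t`. -/
def degree {V : Type*} [Fintype V] (G : SimpleGraph V) (L : Finset V) (a : V → V → ℕ → ℝ)
    (e : V → V → ℕ → ℝ) (t : ℕ) (j i : V) : ℝ :=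
  if j ∈ L then ((trustedNbrs G a t j).card : ℝ) + 1 else e j i t

open Classical in
/-- The weight `w_{ij}(t)` that a legitimate agent `i` gives to an agent `j ≠ i`:
`1_{t ≥ T₀} / (2 max{d_i(t), d_j(t)})` if `j ∈ N_i(t)`, and `0` otherwise. -/
def nbrWeight {V : Type*} [Fintype V] (G : SimpleGraph V) (L : Finset V) (T₀ : ℕ)
    (a : V → V → ℕ → ℝ) (e : V → V → ℕ → ℝ) (t : ℕ) (i j : V) : ℝ :=
  if j ∈ trustedNbrs G a t i then
    (if T₀ ≤ t then 1 else 0) / (2 * max (degree G L a e t i i) (degree G L a e t j i))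
  else 0

open Classical in
/-- The weight `w_{ii}(t) = 1 - ∑_{m ∈ N_i} w_{im}(t)`. -/
def selfWeight {V : Type*} [Fintype V] (G : SimpleGraph V) (L : Finset V) (T₀ : ℕ)
    (a : V → V → ℕ → ℝ) (e : V → V → ℕ → ℝ) (t : ℕ) (i : V) : ℝ :=
  1 - ∑ m ∈ Finset.univ.filter (fun m => G.Adj i m), nbrWeight G L T₀ a e t i m

open Classical in
/-- The mixed value `c_i(t)`, where `x j` is the current value of the legitimate agent `j` and
`v j i t` is the value that the malicious agent `j` sends to agent `i` at time `t`. -/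
def mix {V : Type*} [Fintype V] {d : ℕ} (G : SimpleGraph V) (L : Finset V) (T₀ : ℕ)
    (a : V → V → ℕ → ℝ) (e : V → V → ℕ → ℝ) (v : V → V → ℕ → EuclideanSpace ℝ (Fin d))
    (t : ℕ) (x : V → EuclideanSpace ℝ (Fin d)) (i : V) : EuclideanSpace ℝ (Fin d) :=
  selfWeight G L T₀ a e t i • x i
    + ∑ j ∈ (trustedNbrs G a t i).filter (fun j => j ∈ L), nbrWeight G L T₀ a e t i j • x j
    + ∑ j ∈ (trustedNbrs G a t i).filter (fun j => j ∉ L), nbrWeight G L T₀ a e t i j • v j i t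

/-- The delayed stepsize `γ(t - T₀)`, with `γ(k) = 0` for `k < 0`. -/
def delayedStep (γ : ℕ → ℝ) (T₀ t : ℕ) : ℝ :=
  if T₀ ≤ t then γ (t - T₀) else 0

/-- The iterates of the trust-weighted projected distributed gradient method along one
realization: `x_i(0) = x₀ i` and
`x_i(t+1) = Π_X(c_i(t) - γ(t - T₀) ∇f_i(c_i(t)))`.
Only the entries with `i ∈ L` are meaningful: the update of an agent in `L` never reads an entry
outside `L` (malicious agents enter only through `v` and `e`). -/
def iterate {V : Type*} [Fintype V] {d : ℕ} (G : SimpleGraph V) (L : Finset V)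
    (X : Set (EuclideanSpace ℝ (Fin d))) (f : V → EuclideanSpace ℝ (Fin d) → ℝ)
    (γ : ℕ → ℝ) (T₀ : ℕ) (a : V → V → ℕ → ℝ) (e : V → V → ℕ → ℝ)
    (v : V → V → ℕ → EuclideanSpace ℝ (Fin d)) (x₀ : V → EuclideanSpace ℝ (Fin d)) :
    ℕ → V → EuclideanSpace ℝ (Fin d)
  | 0 => x₀
  | t + 1 => fun i =>
      let c := mix G L T₀ a e v t (iterate G L X f γ T₀ a e v x₀ t) i
      proj X (c - delayedStep γ T₀ t • gradient (f i) c)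

end

end TrustOpt

/-! By the strong law, almost surely each average `trustSum / n` tends to a positive limit on
legitimate edges and a negative one on malicious edges. There are finitely many edges, so from some
random finite time on every trusted neighborhood consists exactly of the legitimate neighbors
(`eventually_trustedNbrs_eq`). After that time and after `T₀`, malicious inputs drop out and mixing
is averaging with one fixed matrix (`mix_eq`): symmetric thanks to the `max` in the weights,
stochastic, with diagonal at least 1/2 thanks to the factor 2, and with connected support. The
earlier history matters only through the restart points, which lie in `X`.

What remains is the deterministic theorem `tendsto_of_distributed_gradient`, for steps `η → 0` with
divergent sum. Averaging contracts the dispersion around the mean by a fixed factor while each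
gradient step perturbs by `O(η)`, so the dispersion vanishes (`tendsto_dispersion_zero`). Strong
convexity then gives, for the total squared distance `U` to the optimum, `U (t+1) ≤ (1 - m η) U t +
η o(1)`, which forces `U → 0` (`tendsto_zero_of_le_one_sub_mul_add`). -/

namespace TrustOpt

/-! ### A scalar recursion. -/

/-- A nonnegative sequence with `u (t+1) ≤ (1 - a t) u t + a t δ t`, where `∑ a = ∞` and `δ → 0`,
tends to zero. -/
theorem tendsto_zero_of_le_one_sub_mul_add {u a δ : ℕ → ℝ} (hu : ∀ t, 0 ≤ u t)
    (ha : ∀ t, 0 ≤ a t) (ha1 : ∀ᶠ t in atTop, a t ≤ 1)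
    (hsum : Tendsto (fun n => ∑ t ∈ Finset.range n, a t) atTop atTop)
    (hδ : Tendsto δ atTop (𝓝 0))
    (hstep : ∀ᶠ t in atTop, u (t + 1) ≤ (1 - a t) * u t + a t * δ t) :
    Tendsto u atTop (𝓝 0) := by
  -- Once `δ t < ε`, the excess of `u` over `ε` shrinks by the factor `1 - a t ≤ exp (-a t)`; these
  -- factors multiply to zero because the sum of `a` diverges.
  have key : ∀ ε > 0, Tendsto (fun t => max (u t - ε) 0) atTop (𝓝 0) := by
    intro ε hε
    have hev : ∀ᶠ t in atTop, max (u (t + 1) - ε) 0 ≤ Real.exp (-a t) * max (u t - ε) 0 := by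
      filter_upwards [ha1, hstep, hδ.eventually (gt_mem_nhds hε)] with t h1 h2 h3
      have h4 : u (t + 1) - ε ≤ (1 - a t) * (u t - ε) := by nlinarith [ha t]
      have h5 : 1 - a t ≤ Real.exp (-a t) := by linarith [Real.add_one_le_exp (-a t)]
      refine max_le (h4.trans ?_) (by positivity)
      calc (1 - a t) * (u t - ε) ≤ (1 - a t) * max (u t - ε) 0 :=
            mul_le_mul_of_nonneg_left (le_max_left _ _) (by linarith)
        _ ≤ _ := mul_le_mul_of_nonneg_right h5 (le_max_right _ _)
    obtain ⟨N, hN⟩ := eventually_atTop.1 hev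
    set A : ℕ → ℝ := fun n => ∑ t ∈ Finset.range n, a t with hA
    have hbound : ∀ n ≥ N, max (u n - ε) 0 ≤ Real.exp (A N - A n) * max (u N - ε) 0 := by
      intro n hn
      induction n, hn using Nat.le_induction with
      | base => simp
      | succ n hn ih =>
        have hexp : Real.exp (A N - A (n + 1)) = Real.exp (-a n) * Real.exp (A N - A n) := by
          rw [← Real.exp_add]
          congr 1
          simp only [hA, Finset.sum_range_succ]
          ring
        rw [hexp, mul_assoc]
        exact (hN n hn).trans (mul_le_mul_of_nonneg_left ih (Real.exp_pos _).le)
    have hlim : Tendsto (fun n => Real.exp (A N - A n) * max (u N - ε) 0) atTop (𝓝 0) := by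
      have : Tendsto (fun n => Real.exp (A N - A n)) atTop (𝓝 0) :=
        Real.tendsto_exp_atBot.comp
          (tendsto_atBot_add_const_left _ (A N) (tendsto_neg_atTop_atBot.comp hsum))
      simpa using this.mul_const (max (u N - ε) 0)
    exact squeeze_zero' (Eventually.of_forall fun _ => le_max_right _ _)
      (eventually_atTop.2 ⟨N, hbound⟩) hlim
  rw [Metric.tendsto_atTop']
  intro ε hε
  obtain ⟨N, hN⟩ := eventually_atTop.1
    ((key (ε / 2) (half_pos hε)).eventually (gt_mem_nhds (half_pos hε)))
  refine ⟨N, fun n hn => ?_⟩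
  have h1 := (le_max_left (u n - ε / 2) 0).trans_lt (hN n hn.le)
  rw [Real.dist_eq, sub_zero, abs_of_nonneg (hu n)]
  linarith

/-! ### Averaging by symmetric stochastic matrices and consensus. -/

section Averaging

variable {ι E : Type*} [Fintype ι] [NormedAddCommGroup E] [InnerProductSpace ℝ E]

/-- The parallel axis identity for a weighted mean. -/
theorem sum_mul_norm_sub_sq {p : ι → ℝ} (hp : ∑ j, p j = 1) (y : ι → E) (z : E) :
    ∑ j, p j * ‖y j - z‖ ^ 2
      = ∑ j, p j * ‖y j - ∑ k, p k • y k‖ ^ 2 + ‖∑ k, p k • y k - z‖ ^ 2 := by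
  set c := ∑ k, p k • y k with hc
  have h : ∀ j, p j * ‖y j - z‖ ^ 2
      = p j * ‖y j - c‖ ^ 2 + 2 * inner ℝ (p j • (y j - c)) (c - z) + p j * ‖c - z‖ ^ 2 := by
    intro j
    rw [show y j - z = (y j - c) + (c - z) by abel, norm_add_sq_real, real_inner_smul_left]
    ring
  have h0 : ∑ j, p j • (y j - c) = 0 := by
    simp_rw [smul_sub]
    rw [Finset.sum_sub_distrib, ← Finset.sum_smul, hp, one_smul, ← hc, sub_self]
  simp_rw [h]
  rw [Finset.sum_add_distrib, Finset.sum_add_distrib, ← Finset.mul_sum, ← sum_inner, h0,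
    inner_zero_left, ← Finset.sum_mul, hp]
  ring

/-- A weighted mean putting weight at least `1/2` on `i` gains a multiple of the weighted
dispersion around `y i`. -/
theorem norm_weightedMean_sub_sq_le {p : ι → ℝ} (hp0 : ∀ j, 0 ≤ p j) (hp : ∑ j, p j = 1) {i : ι}
    (hi : 1 / 2 ≤ p i) (y : ι → E) (z : E) :
    ‖∑ k, p k • y k - z‖ ^ 2
      ≤ ∑ j, p j * ‖y j - z‖ ^ 2 - 1 / 3 * ∑ j, p j * ‖y j - y i‖ ^ 2 := by
  have h1 := sum_mul_norm_sub_sq hp y z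
  have h2 := sum_mul_norm_sub_sq hp y (y i)
  have h3 : p i * ‖y i - ∑ k, p k • y k‖ ^ 2 ≤ ∑ j, p j * ‖y j - ∑ k, p k • y k‖ ^ 2 :=
    Finset.single_le_sum (f := fun j => p j * ‖y j - ∑ k, p k • y k‖ ^ 2)
      (fun j _ => mul_nonneg (hp0 j) (sq_nonneg _)) (Finset.mem_univ i)
  rw [norm_sub_rev (y i)] at h3
  -- Let `W` be the dispersion around `y i`, `S` that around the mean `c`. Then `W = S + ‖c - y i‖²`
  -- and `S ≥ ‖c - y i‖² / 2`, hence `S ≥ W / 3`.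
  nlinarith [sq_nonneg ‖∑ k, p k • y k - y i‖]

/-- The arithmetic mean of a finite family. -/
noncomputable def mean (y : ι → E) : E := ∑ i, (1 / (Fintype.card ι : ℝ)) • y i

theorem sum_one_div_card [Nonempty ι] : ∑ _i : ι, 1 / (Fintype.card ι : ℝ) = 1 := by
  have : (Fintype.card ι : ℝ) ≠ 0 := by exact_mod_cast Fintype.card_ne_zero
  simp [this]

theorem mean_mem [Nonempty ι] {X : Set E} (hX : Convex ℝ X) {y : ι → E}
    (hy : ∀ i, y i ∈ X) : mean y ∈ X :=
  hX.sum_mem (fun _ _ => by positivity) sum_one_div_card fun i _ => hy i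

/-- The mean minimizes the sum of squared distances. -/
theorem sum_norm_sub_mean_sq_le [Nonempty ι] (y : ι → E) (z : E) :
    ∑ i, ‖y i - mean y‖ ^ 2 ≤ ∑ i, ‖y i - z‖ ^ 2 := by
  have h := sum_mul_norm_sub_sq (sum_one_div_card (ι := ι)) y z
  rw [← Finset.mul_sum, ← Finset.mul_sum] at h
  have hpos : 0 < 1 / (Fintype.card ι : ℝ) := by
    have : 0 < Fintype.card ι := Fintype.card_pos
    positivity
  refine le_of_mul_le_mul_left ?_ hpos
  rw [h]
  exact le_add_of_nonneg_right (sq_nonneg _)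

/-- The averaging step of a symmetric stochastic matrix whose diagonal entries are at least
`1/2`. -/
theorem sum_norm_weightedMean_sub_sq_le {w : ι → ι → ℝ} (hw0 : ∀ i j, 0 ≤ w i j)
    (hsymm : ∀ i j, w i j = w j i) (hrow : ∀ i, ∑ j, w i j = 1) (hdiag : ∀ i, 1 / 2 ≤ w i i)
    (y : ι → E) (z : E) :
    ∑ i, ‖∑ j, w i j • y j - z‖ ^ 2
      ≤ ∑ i, ‖y i - z‖ ^ 2 - 1 / 3 * ∑ i, ∑ j, w i j * ‖y j - y i‖ ^ 2 := by
  calc ∑ i, ‖∑ j, w i j • y j - z‖ ^ 2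
      ≤ ∑ i, (∑ j, w i j * ‖y j - z‖ ^ 2 - 1 / 3 * ∑ j, w i j * ‖y j - y i‖ ^ 2) :=
        Finset.sum_le_sum fun i _ => norm_weightedMean_sub_sq_le (hw0 i) (hrow i) (hdiag i) y z
    _ = _ := by
        rw [Finset.sum_sub_distrib, ← Finset.mul_sum, Finset.sum_comm]
        congr 1
        refine Finset.sum_congr rfl fun j _ => ?_
        simp_rw [hsymm _ j]
        rw [← Finset.sum_mul, hrow, one_mul]

/-- A Poincaré-type inequality: along a path of positive weights each edge difference is controlled
by its own term of the dispersion, with a constant independent of `y`. Adding an edge costs a factor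
2, from `(p + q)² ≤ 2p² + 2q²`. -/
theorem exists_norm_sub_sq_le_mul_dispersion {E : Type*} [NormedAddCommGroup E]
    {w : ι → ι → ℝ} (hw0 : ∀ i j, 0 ≤ w i j)
    {i j : ι} (hij : Relation.ReflTransGen (fun a b => 0 < w a b) i j) :
    ∃ C, 0 ≤ C ∧ ∀ y : ι → E, ‖y j - y i‖ ^ 2 ≤ C * ∑ a, ∑ b, w a b * ‖y b - y a‖ ^ 2 := by
  induction hij with
  | refl => exact ⟨0, le_rfl, fun y => by simp⟩
  | @tail b c _ hbc ih =>
    obtain ⟨C, hC, h⟩ := ih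
    refine ⟨2 * (C + 1 / w b c), by positivity, fun y => ?_⟩
    set D := ∑ a, ∑ b, w a b * ‖y b - y a‖ ^ 2 with hD
    have h1 : w b c * ‖y c - y b‖ ^ 2 ≤ D := by
      have hnn : ∀ a b, 0 ≤ w a b * ‖y b - y a‖ ^ 2 := fun a b =>
        mul_nonneg (hw0 a b) (sq_nonneg _)
      exact (Finset.single_le_sum (f := fun d => w b d * ‖y d - y b‖ ^ 2)
          (fun d _ => hnn b d) (Finset.mem_univ c)).trans
        (Finset.single_le_sum (f := fun a => ∑ d, w a d * ‖y d - y a‖ ^ 2)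
          (fun a _ => Finset.sum_nonneg fun d _ => hnn a d) (Finset.mem_univ b))
    have h2 : ‖y c - y b‖ ^ 2 ≤ 1 / w b c * D := by
      rw [one_div, inv_mul_eq_div, le_div_iff₀ hbc]
      linarith
    have h3 : ‖y c - y i‖ ≤ ‖y c - y b‖ + ‖y b - y i‖ := norm_sub_le_norm_sub_add_norm_sub _ _ _
    have h4 : ‖y c - y i‖ ^ 2 ≤ (‖y c - y b‖ + ‖y b - y i‖) ^ 2 :=
      pow_le_pow_left₀ (norm_nonneg _) h3 2
    nlinarith [h y, sq_nonneg (‖y c - y b‖ - ‖y b - y i‖)]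

/-- Averaging with a symmetric stochastic matrix with diagonal at least `1/2` and connected
support contracts the dispersion around the mean. -/
theorem exists_contraction_dispersion [Nonempty ι] {w : ι → ι → ℝ} (hw0 : ∀ i j, 0 ≤ w i j)
    (hsymm : ∀ i j, w i j = w j i) (hrow : ∀ i, ∑ j, w i j = 1) (hdiag : ∀ i, 1 / 2 ≤ w i i)
    (hconn : ∀ i j, Relation.ReflTransGen (fun a b => 0 < w a b) i j) :
    ∃ κ : ℝ, 0 < κ ∧ κ ≤ 1 ∧ ∀ y : ι → E,
      ∑ i, ‖∑ j, w i j • y j - mean y‖ ^ 2 ≤ (1 - κ) * ∑ i, ‖y i - mean y‖ ^ 2 := by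
  obtain ⟨i₀⟩ := ‹Nonempty ι›
  choose C hC0 hC using fun j => exists_norm_sub_sq_le_mul_dispersion (E := E) hw0 (hconn i₀ j)
  have hS : 0 ≤ ∑ j, C j := Finset.sum_nonneg fun j _ => hC0 j
  -- Averaging gains `D / 3`, and the distance to the mean is at most `(1 + ∑ C) D`; the summand 1
  -- keeps the denominator positive and `κ ≤ 1`.
  refine ⟨1 / (3 * (1 + ∑ j, C j)), by positivity, ?_, fun y => ?_⟩
  · rw [div_le_one (by positivity)]
    linarith
  set D := ∑ a, ∑ b, w a b * ‖y b - y a‖ ^ 2 with hD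
  have hD0 : 0 ≤ D := Finset.sum_nonneg fun a _ => Finset.sum_nonneg fun b _ =>
    mul_nonneg (hw0 a b) (sq_nonneg _)
  have h1 := sum_norm_weightedMean_sub_sq_le hw0 hsymm hrow hdiag y (mean y)
  have h2 : ∑ i, ‖y i - mean y‖ ^ 2 ≤ (1 + ∑ j, C j) * D := by
    have : Nonempty ι := ⟨i₀⟩
    calc ∑ i, ‖y i - mean y‖ ^ 2 ≤ ∑ i, ‖y i - y i₀‖ ^ 2 := sum_norm_sub_mean_sq_le y _
      _ ≤ ∑ i, C i * D := Finset.sum_le_sum fun i _ => hC i y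
      _ ≤ _ := by rw [← Finset.sum_mul]; nlinarith
  have h3 : 1 / (3 * (1 + ∑ j, C j)) * ∑ i, ‖y i - mean y‖ ^ 2 ≤ 1 / 3 * D := by
    rw [one_div, inv_mul_eq_div, div_le_iff₀ (by positivity)]
    linarith
  linarith

/-- Consensus under vanishing perturbations. -/
theorem tendsto_dispersion_zero [Nonempty ι] {w : ι → ι → ℝ} (hw0 : ∀ i j, 0 ≤ w i j)
    (hsymm : ∀ i j, w i j = w j i) (hrow : ∀ i, ∑ j, w i j = 1) (hdiag : ∀ i, 1 / 2 ≤ w i i)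
    (hconn : ∀ i j, Relation.ReflTransGen (fun a b => 0 < w a b) i j)
    {x : ℕ → ι → E} {b : ℕ → ℝ} (hb : Tendsto b atTop (𝓝 0))
    (hx : ∀ t i, ‖x (t + 1) i - ∑ j, w i j • x t j‖ ≤ b t) :
    Tendsto (fun t => ∑ i, ‖x t i - mean (x t)‖ ^ 2) atTop (𝓝 0) := by
  obtain ⟨κ, hκ, hκ1, hcontr⟩ := exists_contraction_dispersion (E := E) hw0 hsymm hrow hdiag hconn
  -- Half of the contraction rate pays for the cross term: `(b + c)² ≤ (1 + κ/2) c² + (1 + 2/κ) b²`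
  -- and `(1 + κ/2)(1 - κ) ≤ 1 - κ/2`. The leading `2 / κ` writes the error as the rate `κ / 2`
  -- times `δ`.
  have hδ : Tendsto (fun t => 2 / κ * (Fintype.card ι * ((1 + 2 / κ) * b t ^ 2))) atTop (𝓝 0) := by
    have := (((hb.pow 2).const_mul (1 + 2 / κ)).const_mul (Fintype.card ι : ℝ)).const_mul (2 / κ)
    simpa using this
  refine tendsto_zero_of_le_one_sub_mul_add (a := fun _ => κ / 2)
    (fun t => by positivity) (fun _ => by positivity)
    (Eventually.of_forall fun _ => by linarith) ?_ hδ (Eventually.of_forall fun t => ?_)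
  · simp only [Finset.sum_const, Finset.card_range, nsmul_eq_mul]
    exact tendsto_natCast_atTop_atTop.atTop_mul_const (by positivity)
  have hpt : ∀ i, ‖x (t + 1) i - mean (x t)‖ ^ 2
      ≤ (1 + κ / 2) * ‖∑ j, w i j • x t j - mean (x t)‖ ^ 2 + (1 + 2 / κ) * b t ^ 2 := by
    intro i
    set c := ‖∑ j, w i j • x t j - mean (x t)‖
    have h1 : ‖x (t + 1) i - mean (x t)‖ ≤ b t + c :=
      (norm_sub_le_norm_sub_add_norm_sub _ (∑ j, w i j • x t j) _).trans
        (add_le_add_left (hx t i) _)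
    have h2 : ‖x (t + 1) i - mean (x t)‖ ^ 2 ≤ (b t + c) ^ 2 :=
      pow_le_pow_left₀ (norm_nonneg _) h1 2
    have h3 : (1 + κ / 2) * c ^ 2 + (1 + 2 / κ) * b t ^ 2 - (b t + c) ^ 2
        = (κ * c - 2 * b t) ^ 2 / (2 * κ) := by
      field_simp
      ring
    have h4 : 0 ≤ (κ * c - 2 * b t) ^ 2 / (2 * κ) := by positivity
    linarith
  -- Recentering at the old mean only increases the sum, so the drift of the mean need not be
  -- tracked.
  calc ∑ i, ‖x (t + 1) i - mean (x (t + 1))‖ ^ 2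
      ≤ ∑ i, ‖x (t + 1) i - mean (x t)‖ ^ 2 := sum_norm_sub_mean_sq_le _ _
    _ ≤ ∑ i, ((1 + κ / 2) * ‖∑ j, w i j • x t j - mean (x t)‖ ^ 2 + (1 + 2 / κ) * b t ^ 2) :=
        Finset.sum_le_sum fun i _ => hpt i
    _ = (1 + κ / 2) * ∑ i, ‖∑ j, w i j • x t j - mean (x t)‖ ^ 2
          + Fintype.card ι * ((1 + 2 / κ) * b t ^ 2) := by
        rw [Finset.sum_add_distrib, ← Finset.mul_sum]
        simp
    _ ≤ (1 + κ / 2) * ((1 - κ) * ∑ i, ‖x t i - mean (x t)‖ ^ 2)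
          + Fintype.card ι * ((1 + 2 / κ) * b t ^ 2) := by
        gcongr
        exact hcontr (x t)
    _ ≤ (1 - κ / 2) * ∑ i, ‖x t i - mean (x t)‖ ^ 2
          + Fintype.card ι * ((1 + 2 / κ) * b t ^ 2) := by
        have : 0 ≤ ∑ i, ‖x t i - mean (x t)‖ ^ 2 := by positivity
        nlinarith [mul_nonneg (mul_nonneg hκ.le hκ.le) this]
    _ = _ := by
        congr 1
        field_simp

end Averaging

/-! ### Projection and strong convexity. -/

section Optimization

variable {d : ℕ}

/-- The variational inequality makes the angle at the projected point `p` obtuse, so `‖y - z‖² ≥ ‖y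
- p‖² + ‖p - z‖²`. -/
theorem norm_proj_sub_le {X : Set (EuclideanSpace ℝ (Fin d))} (hX : IsCompact X)
    (hconv : Convex ℝ X) (y : EuclideanSpace ℝ (Fin d)) {z : EuclideanSpace ℝ (Fin d)}
    (hz : z ∈ X) : ‖proj X y - z‖ ≤ ‖y - z‖ := by
  obtain ⟨hp, hmin⟩ := proj_spec hX ⟨z, hz⟩ y
  set p := proj X y
  have hinf : ‖y - p‖ = ⨅ u : X, ‖y - u‖ := by
    have : Nonempty X := ⟨⟨z, hz⟩⟩
    refine le_antisymm (le_ciInf fun u => ?_) (ciInf_le ⟨0, ?_⟩ (⟨p, hp⟩ : X))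
    · rw [norm_sub_rev y, norm_sub_rev y]
      exact hmin u u.2
    · rintro _ ⟨u, rfl⟩
      exact norm_nonneg _
  have hvar := (norm_eq_iInf_iff_real_inner_le_zero hconv hp).1 hinf z hz
  have hexp : ‖y - z‖ ^ 2 = ‖y - p‖ ^ 2 - 2 * inner ℝ (y - p) (z - p) + ‖p - z‖ ^ 2 := by
    rw [show y - z = (y - p) - (z - p) by abel, norm_sub_sq_real, norm_sub_rev z p]
  exact le_of_sq_le_sq (by nlinarith [sq_nonneg ‖y - p‖]) (norm_nonneg _)

variable {E : Type*} [NormedAddCommGroup E] [InnerProductSpace ℝ E] [CompleteSpace E]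

/-- The first-order characterization of strong convexity. -/
theorem add_inner_gradient_le_of_strongConvexOn {f : E → ℝ} {m : ℝ}
    (hf : StrongConvexOn Set.univ m f) {x : E} (hd : DifferentiableAt ℝ f x) (y : E) :
    f x + inner ℝ (gradient f x) (y - x) + m / 2 * ‖y - x‖ ^ 2 ≤ f y := by
  have h1 := (hd.hasGradientAt.hasFDerivAt.hasLineDerivAt (y - x)).tendsto_slope_zero_right
  rw [InnerProductSpace.toDual_apply_apply] at h1
  -- Strong convexity on the segment from `x` to `y`, divided by `s`, bounds the difference quotient
  -- by this function; then `s` tends to zero from the right.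
  have h2 : Tendsto (fun s : ℝ => f y - f x - (1 - s) * (m / 2 * ‖y - x‖ ^ 2)) (𝓝[>] 0)
      (𝓝 (f y - f x - (1 - 0) * (m / 2 * ‖y - x‖ ^ 2))) :=
    ((by fun_prop : Continuous fun s : ℝ =>
      f y - f x - (1 - s) * (m / 2 * ‖y - x‖ ^ 2)).tendsto 0).mono_left nhdsWithin_le_nhds
  have h3 := le_of_tendsto_of_tendsto h1 h2 (by
    filter_upwards [Ioo_mem_nhdsGT (zero_lt_one' ℝ)] with s hs
    obtain ⟨-, hf'⟩ := hf
    have := hf' (Set.mem_univ x) (Set.mem_univ y) (a := 1 - s) (b := s)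
      (by linarith [hs.2]) hs.1.le (by ring)
    rw [show (1 - s) • x + s • y = x + s • (y - x) by module, norm_sub_rev x y] at this
    simp only [smul_eq_mul] at this ⊢
    rw [inv_mul_eq_div, div_le_iff₀ hs.1]
    nlinarith)
  linarith

end Optimization

/-! ### The distributed gradient method with fixed weights. -/

section Deterministic

variable {d : ℕ} {ι : Type*} [Fintype ι] [Nonempty ι]

/-- Deterministic convergence of the projected distributed gradient iteration with a fixed
symmetric stochastic weight matrix. -/
theorem tendsto_of_distributed_gradient {w : ι → ι → ℝ} (hw0 : ∀ i j, 0 ≤ w i j)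
    (hsymm : ∀ i j, w i j = w j i) (hrow : ∀ i, ∑ j, w i j = 1) (hdiag : ∀ i, 1 / 2 ≤ w i i)
    (hconn : ∀ i j, Relation.ReflTransGen (fun a b => 0 < w a b) i j)
    {X : Set (EuclideanSpace ℝ (Fin d))} (hX : IsCompact X) (hconv : Convex ℝ X)
    {F : ι → EuclideanSpace ℝ (Fin d) → ℝ}
    {g : ι → EuclideanSpace ℝ (Fin d) → EuclideanSpace ℝ (Fin d)} {m B : ℝ} (hm : 0 < m)
    (hFg : ∀ i x y, F i x + inner ℝ (g i x) (y - x) + m / 2 * ‖y - x‖ ^ 2 ≤ F i y)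
    (hB : ∀ i, ∀ x ∈ X, ‖g i x‖ ≤ B)
    {η : ℕ → ℝ} (hη0 : ∀ t, 0 ≤ η t) (hη : Tendsto η atTop (𝓝 0))
    (hηsum : Tendsto (fun n => ∑ t ∈ Finset.range n, η t) atTop atTop)
    {xs : EuclideanSpace ℝ (Fin d)} (hxs : xs ∈ X) (hmin : ∀ z ∈ X, ∑ i, F i xs ≤ ∑ i, F i z)
    {x : ℕ → ι → EuclideanSpace ℝ (Fin d)} (hxX : ∀ t i, x t i ∈ X)
    (hstep : ∀ t i, x (t + 1) i
      = proj X (∑ j, w i j • x t j - η t • g i (∑ j, w i j • x t j))) (i : ι) :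
    Tendsto (fun t => x t i) atTop (𝓝 xs) := by
  set c : ℕ → ι → EuclideanSpace ℝ (Fin d) := fun t i => ∑ j, w i j • x t j with hc
  have hcX : ∀ t i, c t i ∈ X := fun t i =>
    hconv.sum_mem (fun j _ => hw0 i j) (hrow i) fun j _ => hxX t j
  have hB0 : 0 ≤ B := (norm_nonneg _).trans (hB i xs hxs)
  -- The averaged point already lies in `X`, so projecting brings the iterate no farther from it
  -- than the gradient step did.
  have hpert : ∀ t i, ‖x (t + 1) i - ∑ j, w i j • x t j‖ ≤ η t * B := by
    intro t i
    rw [hstep]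
    refine (norm_proj_sub_le hX hconv _ (hcX t i)).trans ?_
    rw [show c t i = ∑ j, w i j • x t j from rfl, sub_sub_cancel_left, norm_neg, norm_smul,
      Real.norm_of_nonneg (hη0 t)]
    exact mul_le_mul_of_nonneg_left (hB i _ (hcX t i)) (hη0 t)
  set D : ℕ → ℝ := fun t => ∑ i, ‖x t i - mean (x t)‖ ^ 2 with hD
  have hDlim : Tendsto D atTop (𝓝 0) :=
    tendsto_dispersion_zero hw0 hsymm hrow hdiag hconn (by simpa using hη.mul_const B) hpert
  have hcD : ∀ t i, ‖c t i - mean (x t)‖ ≤ √(D t) := by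
    intro t i
    refine Real.le_sqrt_of_sq_le ?_
    have h1 := sum_norm_weightedMean_sub_sq_le hw0 hsymm hrow hdiag (x t) (mean (x t))
    have h2 : 0 ≤ ∑ i, ∑ j, w i j * ‖x t j - x t i‖ ^ 2 :=
      Finset.sum_nonneg fun a _ => Finset.sum_nonneg fun b _ =>
        mul_nonneg (hw0 a b) (sq_nonneg _)
    have h3 := Finset.single_le_sum (f := fun i => ‖c t i - mean (x t)‖ ^ 2)
      (fun i _ => sq_nonneg _) (Finset.mem_univ i)
    exact h3.trans (by linarith)
  set S : ℕ → ℝ := fun t => ∑ i, ‖c t i - xs‖ ^ 2 with hS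
  set U : ℕ → ℝ := fun t => ∑ i, ‖x t i - xs‖ ^ 2 with hU
  have hSU : ∀ t, S t ≤ U t := by
    intro t
    have h1 := sum_norm_weightedMean_sub_sq_le hw0 hsymm hrow hdiag (x t) xs
    have h2 : 0 ≤ ∑ i, ∑ j, w i j * ‖x t j - x t i‖ ^ 2 :=
      Finset.sum_nonneg fun a _ => Finset.sum_nonneg fun b _ =>
        mul_nonneg (hw0 a b) (sq_nonneg _)
    exact h1.trans (by linarith)
  -- Strong convexity at `c t i` supplies the factor `1 - m η` and the value `F i (c t i)`.
  -- Replacing this value by that at the common mean costs at most `B √(D t)`.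
  have hagent : ∀ t i, ‖x (t + 1) i - xs‖ ^ 2 ≤ (1 - m * η t) * ‖c t i - xs‖ ^ 2
      + 2 * η t * (F i xs - F i (mean (x t))) + η t * (2 * B * √(D t) + η t * B ^ 2) := by
    intro t i
    have h1 : ‖x (t + 1) i - xs‖ ^ 2 ≤ ‖c t i - η t • g i (c t i) - xs‖ ^ 2 := by
      rw [hstep]
      exact pow_le_pow_left₀ (norm_nonneg _) (norm_proj_sub_le hX hconv _ hxs) 2
    have h2 : ‖c t i - η t • g i (c t i) - xs‖ ^ 2 = ‖c t i - xs‖ ^ 2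
        + 2 * η t * inner ℝ (g i (c t i)) (xs - c t i) + η t ^ 2 * ‖g i (c t i)‖ ^ 2 := by
      rw [show c t i - η t • g i (c t i) - xs = (c t i - xs) - η t • g i (c t i) by abel,
        norm_sub_sq_real, real_inner_smul_right, norm_smul, Real.norm_of_nonneg (hη0 t),
        ← neg_sub (c t i) xs, inner_neg_right, real_inner_comm]
      ring
    have h3 := hFg i (c t i) xs
    rw [norm_sub_rev] at h3
    have h4 := hFg i (mean (x t)) (c t i)
    have h5 : -(B * √(D t)) ≤ inner ℝ (g i (mean (x t))) (c t i - mean (x t)) := by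
      have h := abs_real_inner_le_norm (g i (mean (x t))) (c t i - mean (x t))
      have h' := mul_le_mul (hB i _ (mean_mem hconv (hxX t))) (hcD t i) (norm_nonneg _) hB0
      exact (neg_le_neg (h.trans h')).trans (neg_abs_le _)
    have h6 : ‖g i (c t i)‖ ^ 2 ≤ B ^ 2 := pow_le_pow_left₀ (norm_nonneg _) (hB i _ (hcX t i)) 2
    have h7 : 0 ≤ m / 2 * ‖c t i - mean (x t)‖ ^ 2 := by positivity
    have h8 : inner ℝ (g i (c t i)) (xs - c t i)
        ≤ F i xs - F i (mean (x t)) + B * √(D t) - m / 2 * ‖c t i - xs‖ ^ 2 := by linarith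
    have h9 := mul_le_mul_of_nonneg_left h8 (hη0 t)
    have h10 := mul_le_mul_of_nonneg_left h6 (sq_nonneg (η t))
    linarith
  have htotal : ∀ t, U (t + 1) ≤ (1 - m * η t) * S t
      + η t * (Fintype.card ι * (2 * B * √(D t) + η t * B ^ 2)) := by
    intro t
    have h1 := Finset.sum_le_sum fun i (_ : i ∈ Finset.univ) => hagent t i
    rw [Finset.sum_add_distrib, Finset.sum_add_distrib, ← Finset.mul_sum, ← Finset.mul_sum,
      Finset.sum_sub_distrib, Finset.sum_const, Finset.card_univ, nsmul_eq_mul] at h1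
    -- Individual differences `F i xs - F i (mean (x t))` have no sign; their sum is nonpositive
    -- since the mean is in `X`.
    have h2 := hmin _ (mean_mem hconv (hxX t))
    have h3 := mul_nonneg (hη0 t) (sub_nonneg.2 h2)
    simp only [hS, hU]
    linarith
  have hmη : Tendsto (fun t => m * η t) atTop (𝓝 0) := by simpa using hη.const_mul m
  have hev : ∀ᶠ t in atTop, m * η t ≤ 1 :=
    (hmη.eventually (gt_mem_nhds one_pos)).mono fun _ h => h.le
  have hUlim : Tendsto U atTop (𝓝 0) := by
    refine tendsto_zero_of_le_one_sub_mul_add (a := fun t => m * η t)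
      (δ := fun t => Fintype.card ι * (2 * B * √(D t) + η t * B ^ 2) / m)
      (fun t => Finset.sum_nonneg fun _ _ => sq_nonneg _)
      (fun t => mul_nonneg hm.le (hη0 t)) hev ?_ ?_ ?_
    · simp_rw [← Finset.mul_sum]
      exact hηsum.const_mul_atTop hm
    · have h1 := (Real.continuous_sqrt.tendsto 0).comp hDlim
      rw [Real.sqrt_zero] at h1
      simpa using (((h1.const_mul (2 * B)).add (hη.mul_const (B ^ 2))).const_mul
        (Fintype.card ι : ℝ)).div_const m
    · filter_upwards [hev] with t ht
      have h1 := mul_le_mul_of_nonneg_left (hSU t) (sub_nonneg.2 ht)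
      have h2 : m * η t * (Fintype.card ι * (2 * B * √(D t) + η t * B ^ 2) / m)
          = η t * (Fintype.card ι * (2 * B * √(D t) + η t * B ^ 2)) := by
        field_simp
      rw [h2]
      exact (htotal t).trans (by linarith)
  rw [tendsto_iff_norm_sub_tendsto_zero]
  refine squeeze_zero (fun _ => norm_nonneg _) (fun t => Real.le_sqrt_of_sq_le ?_)
    (by have h := (Real.continuous_sqrt.tendsto 0).comp hUlim
        rwa [Real.sqrt_zero] at h)
  exact Finset.single_le_sum (f := fun i => ‖x t i - xs‖ ^ 2)
    (fun i _ => sq_nonneg _) (Finset.mem_univ i)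

end Deterministic

/-! ### Trust observations and the eventual trusted neighborhoods. -/

section Trust

variable {V : Type*} {d : ℕ}

/-- Observations in `[0, 1]` are integrable, so the strong law applies; `trustSum / n` is the
empirical mean minus 1/2. -/
theorem ae_tendsto_trustSum_div {Ω : Type*} [MeasurableSpace Ω] {P : Measure Ω}
    [IsProbabilityMeasure P] {a : ℕ → Ω → ℝ} {c : ℝ} (hmeas : AEMeasurable (a 0) P)
    (hrange : ∀ᵐ ω ∂P, a 0 ω ∈ Set.Icc (0 : ℝ) 1)
    (hmean : (∫ ω, a 0 ω ∂P) - 1 / 2 = c) (hindep : iIndepFun a P)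
    (hident : ∀ t, IdentDistrib (a t) (a 0) P P) :
    ∀ᵐ ω ∂P, Tendsto (fun n : ℕ => trustSum (fun t => a t ω) n / n) atTop (𝓝 c) := by
  filter_upwards [strong_law_ae_real a (Integrable.of_mem_Icc 0 1 hmeas hrange)
    (fun s t hst => hindep.indepFun hst) hident] with ω hω
  rw [← hmean]
  refine (hω.sub_const (1 / 2)).congr' ?_
  filter_upwards [eventually_gt_atTop 0] with n hn
  have : (n : ℝ) ≠ 0 := by exact_mod_cast hn.ne'
  simp only [trustSum, Finset.sum_sub_distrib, Finset.sum_const, Finset.card_range, nsmul_eq_mul]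
  field_simp

open Classical in
/-- If the trust averages have positive limits on legitimate edges and negative limits on malicious
edges, the trusted neighborhoods are eventually the legitimate ones. -/
theorem eventually_trustedNbrs_eq [Fintype V] {G : SimpleGraph V} {L : Finset V}
    {a : V → V → ℕ → ℝ}
    {EL EM : ℝ} (hEL : 0 < EL) (hEM : EM < 0)
    (h : ∀ i ∈ L, ∀ j, G.Adj i j →
      Tendsto (fun n : ℕ => trustSum (a i j) n / n) atTop (𝓝 (if j ∈ L then EL else EM))) :
    ∀ᶠ t in atTop, ∀ i ∈ L, trustedNbrs G a t i = L.filter (G.Adj i) := by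
  have hpair : ∀ i ∈ L, ∀ j, ∀ᶠ t in atTop, G.Adj i j → (0 ≤ trustSum (a i j) t ↔ j ∈ L) := by
    intro i hi j
    by_cases hij : G.Adj i j
    · have hlim := h i hi j hij
      by_cases hj : j ∈ L
      · rw [if_pos hj] at hlim
        filter_upwards [hlim.eventually (lt_mem_nhds hEL)] with t ht _
        refine iff_of_true ?_ hj
        -- The nonstrict sign lemma also covers `t = 0`, where the quotient is zero by convention.
        by_contra hneg
        exact absurd ht (not_lt.2 (div_nonpos_of_nonpos_of_nonneg (not_le.1 hneg).le
          t.cast_nonneg))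
      · rw [if_neg hj] at hlim
        filter_upwards [hlim.eventually (gt_mem_nhds hEM)] with t ht _
        exact iff_of_false (fun hnn => absurd ht (not_lt.2 (div_nonneg hnn t.cast_nonneg))) hj
    · exact Eventually.of_forall fun t h => absurd h hij
  have hall : ∀ᶠ t in atTop, ∀ i, i ∈ L → ∀ j, G.Adj i j → (0 ≤ trustSum (a i j) t ↔ j ∈ L) := by
    refine eventually_all.2 fun i => ?_
    by_cases hi : i ∈ L
    · exact (eventually_all.2 fun j => hpair i hi j).mono fun t ht _ => ht
    · exact Eventually.of_forall fun t h => absurd h hi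
  filter_upwards [hall] with t ht i hi
  ext j
  simp only [trustedNbrs, Finset.mem_filter, Finset.mem_univ, true_and]
  exact ⟨fun h => ⟨(ht i hi j h.1).1 h.2, h.1⟩, fun h => ⟨h.2, (ht i hi j h.2).2 h.1⟩⟩

/-! ### The limiting weight matrix. -/

open Classical in
/-- One plus the number of legitimate neighbors. -/
noncomputable def legitDegree (G : SimpleGraph V) (L : Finset V) (i : V) : ℝ :=
  ((L.filter (G.Adj i)).card : ℝ) + 1

open Classical in
/-- The limiting weight of a legitimate neighbor. -/
noncomputable def legitEdgeWeight (G : SimpleGraph V) (L : Finset V) (i j : V) : ℝ :=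
  if G.Adj i j then 1 / (2 * max (legitDegree G L i) (legitDegree G L j)) else 0

open Classical in
/-- The limiting weight matrix of the legitimate agents. -/
noncomputable def legitWeight (G : SimpleGraph V) (L : Finset V) (i j : L) : ℝ :=
  legitEdgeWeight G L i j + if i = j then 1 - ∑ k : L, legitEdgeWeight G L i k else 0

theorem legitDegree_pos (G : SimpleGraph V) (L : Finset V) (i : V) : 0 < legitDegree G L i := by
  unfold legitDegree
  positivity

theorem legitEdgeWeight_nonneg (G : SimpleGraph V) (L : Finset V) (i j : V) :
    0 ≤ legitEdgeWeight G L i j := by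
  unfold legitEdgeWeight
  have := (legitDegree_pos G L i).trans_le (le_max_left _ (legitDegree G L j))
  split_ifs <;> positivity

theorem legitEdgeWeight_pos {G : SimpleGraph V} (L : Finset V) {i j : V} (h : G.Adj i j) :
    0 < legitEdgeWeight G L i j := by
  unfold legitEdgeWeight
  have := (legitDegree_pos G L i).trans_le (le_max_left _ (legitDegree G L j))
  rw [if_pos h]
  positivity

theorem legitEdgeWeight_comm (G : SimpleGraph V) (L : Finset V) (i j : V) :
    legitEdgeWeight G L i j = legitEdgeWeight G L j i := by
  rw [legitEdgeWeight, legitEdgeWeight, max_comm]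
  classical exact if_congr (G.adj_comm i j) rfl rfl

/-- Each of the `legitDegree - 1` neighbors gets at most `1 / (2 * legitDegree)`. This bound is what
leaves at least half of the weight on the diagonal. -/
theorem sum_legitEdgeWeight_le (G : SimpleGraph V) (L : Finset V) (i : V) :
    ∑ k : L, legitEdgeWeight G L i k ≤ 1 / 2 := by
  classical
  have hi := legitDegree_pos G L i
  rw [Finset.sum_coe_sort L (legitEdgeWeight G L i)]
  unfold legitEdgeWeight
  rw [← Finset.sum_filter]
  calc ∑ k ∈ L.filter (G.Adj i), 1 / (2 * max (legitDegree G L i) (legitDegree G L k))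
      ≤ ∑ _k ∈ L.filter (G.Adj i), 1 / (2 * legitDegree G L i) := by
        refine Finset.sum_le_sum fun k _ => ?_
        gcongr
        exact le_max_left _ _
    _ = (legitDegree G L i - 1) / (2 * legitDegree G L i) := by
        rw [Finset.sum_const, nsmul_eq_mul, legitDegree, add_sub_cancel_right, mul_one_div]
    _ ≤ 1 / 2 := by
        rw [div_le_div_iff₀ (by positivity) two_pos]
        linarith

theorem legitWeight_nonneg (G : SimpleGraph V) (L : Finset V) (i j : L) :
    0 ≤ legitWeight G L i j := by
  refine add_nonneg (legitEdgeWeight_nonneg G L i j) ?_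
  split_ifs
  · linarith [sum_legitEdgeWeight_le G L i]
  · exact le_rfl

theorem legitWeight_comm (G : SimpleGraph V) (L : Finset V) (i j : L) :
    legitWeight G L i j = legitWeight G L j i := by
  by_cases h : i = j
  · rw [h]
  · simp only [legitWeight, legitEdgeWeight_comm G L i j, if_neg h, if_neg (Ne.symm h)]

theorem sum_legitWeight (G : SimpleGraph V) (L : Finset V) (i : L) :
    ∑ j, legitWeight G L i j = 1 := by
  simp [legitWeight, Finset.sum_add_distrib, -Finset.univ_eq_attach]

theorem half_le_legitWeight_self (G : SimpleGraph V) (L : Finset V) (i : L) :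
    1 / 2 ≤ legitWeight G L i i := by
  rw [legitWeight, if_pos rfl]
  linarith [sum_legitEdgeWeight_le G L i, legitEdgeWeight_nonneg G L i i]

theorem reflTransGen_legitWeight {G : SimpleGraph V} {L : Finset V}
    (hconn : (G.induce (L : Set V)).Connected) (i j : L) :
    Relation.ReflTransGen (fun a b => 0 < legitWeight G L a b) i j := by
  refine Relation.ReflTransGen.mono (fun a b hab => ?_) i j
    ((SimpleGraph.reachable_iff_reflTransGen _ _).1 (hconn.preconnected i j))
  have hab' : G.Adj a b := hab
  rw [legitWeight, if_neg fun h : a = b => hab.ne h, add_zero]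
  exact legitEdgeWeight_pos L hab'

theorem sum_legitWeight_smul (G : SimpleGraph V) (L : Finset V) (i : L)
    (x : V → EuclideanSpace ℝ (Fin d)) :
    ∑ j : L, legitWeight G L i j • x j
      = (1 - ∑ k ∈ L, legitEdgeWeight G L i k) • x i + ∑ j ∈ L, legitEdgeWeight G L i j • x j := by
  rw [← Finset.sum_coe_sort L (legitEdgeWeight G L i),
    ← Finset.sum_coe_sort L (fun j => legitEdgeWeight G L i j • x j)]
  simp [legitWeight, add_smul, ite_smul, Finset.sum_add_distrib, add_comm,
    -Finset.univ_eq_attach]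

open Classical in
/-- Once the trusted neighborhoods are the legitimate ones, the mixing step is the averaging step
of `legitWeight`. -/
theorem mix_eq [Fintype V] {G : SimpleGraph V} {L : Finset V} {T₀ t : ℕ} {a : V → V → ℕ → ℝ}
    (ht : T₀ ≤ t) (hN : ∀ i ∈ L, trustedNbrs G a t i = L.filter (G.Adj i))
    (e : V → V → ℕ → ℝ) (v : V → V → ℕ → EuclideanSpace ℝ (Fin d))
    (x : V → EuclideanSpace ℝ (Fin d)) (i : L) :
    mix G L T₀ a e v t x i = ∑ j : L, legitWeight G L i j • x j := by
  have hdeg : ∀ j ∈ L, ∀ k, degree G L a e t j k = legitDegree G L j := by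
    intro j hj k
    rw [degree, if_pos hj, hN j hj, legitDegree]
  -- Malicious agents are no longer trusted, so the degrees they report do not influence any weight.
  have hw : ∀ j, nbrWeight G L T₀ a e t i j = if j ∈ L then legitEdgeWeight G L i j else 0 := by
    intro j
    by_cases hj : j ∈ L
    · rw [nbrWeight, hN i i.2, hdeg i i.2, hdeg j hj, if_pos ht, if_pos hj, legitEdgeWeight]
      simp [hj]
    · rw [nbrWeight, hN i i.2, if_neg hj, if_neg (by simp [hj])]
  have hself : selfWeight G L T₀ a e t i = 1 - ∑ k ∈ L, legitEdgeWeight G L i k := by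
    rw [selfWeight]
    simp_rw [hw]
    rw [Finset.sum_ite_mem]
    congr 1
    refine Finset.sum_subset Finset.inter_subset_right fun k hk hk' => ?_
    rw [legitEdgeWeight, if_neg]
    exact fun h => hk' (by simp [hk, h])
  have h1 : (trustedNbrs G a t i).filter (fun j => j ∉ L) = ∅ := by
    rw [hN i i.2, Finset.filter_eq_empty_iff]
    exact fun j hj => not_not.2 (Finset.mem_filter.1 hj).1
  have h2 : ∑ j ∈ (trustedNbrs G a t i).filter (fun j => j ∈ L),
      nbrWeight G L T₀ a e t i j • x j = ∑ j ∈ L, legitEdgeWeight G L i j • x j := by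
    rw [hN i i.2, Finset.filter_filter]
    simp_rw [hw]
    refine (Finset.sum_congr rfl fun j hj => by rw [if_pos (Finset.mem_filter.1 hj).1]).trans
      (Finset.sum_subset (Finset.filter_subset _ _) fun k hk hk' => ?_)
    rw [legitEdgeWeight, if_neg, zero_smul]
    exact fun h => hk' (by simp [hk, h])
  rw [mix, hself, h1, h2, Finset.sum_empty, add_zero, sum_legitWeight_smul]

/-- The projection keeps iterates in `X` whatever was received, so the method may be restarted at
any later time from admissible points. -/
theorem iterate_mem [Fintype V] {G : SimpleGraph V} {L : Finset V}
    {X : Set (EuclideanSpace ℝ (Fin d))} (hX : IsCompact X) (hXne : X.Nonempty)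
    (f : V → EuclideanSpace ℝ (Fin d) → ℝ) (γ : ℕ → ℝ) (T₀ : ℕ) (a e : V → V → ℕ → ℝ)
    (v : V → V → ℕ → EuclideanSpace ℝ (Fin d))
    {x₀ : V → EuclideanSpace ℝ (Fin d)} (hx₀ : ∀ i ∈ L, x₀ i ∈ X) (t : ℕ) {i : V} (hi : i ∈ L) :
    iterate G L X f γ T₀ a e v x₀ t i ∈ X := by
  cases t with
  | zero => exact hx₀ i hi
  | succ t => exact (proj_spec hX hXne _).1

/-! ### Convergence along one realization, and strict convexity of the average. -/

open Classical in
/-- Convergence along a realization in which the trusted neighborhoods are eventually the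
legitimate ones. -/
theorem tendsto_iterate [Fintype V] {G : SimpleGraph V} {L : Finset V}
    (hconn : (G.induce (L : Set V)).Connected)
    {X : Set (EuclideanSpace ℝ (Fin d))} (hX : IsCompact X) (hconv : Convex ℝ X)
    {f : V → EuclideanSpace ℝ (Fin d) → ℝ} {m : ℝ} (hm : 0 < m)
    (hf_strong : ∀ i ∈ L, StrongConvexOn Set.univ m (f i))
    (hf_diff : ∀ i ∈ L, Differentiable ℝ (f i))
    (hf_cont : ∀ i ∈ L, Continuous (gradient (f i)))
    {γ : ℕ → ℝ} (hγ0 : ∀ t, 0 ≤ γ t) (hγ : Tendsto γ atTop (𝓝 0))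
    (hγsum : Tendsto (fun n => ∑ t ∈ Finset.range n, γ t) atTop atTop)
    {xs : EuclideanSpace ℝ (Fin d)} (hxs : xs ∈ X)
    (hmin : IsMinOn (fun z => ∑ i ∈ L, f i z) X xs)
    {T₀ : ℕ} {a : V → V → ℕ → ℝ}
    (hN : ∀ᶠ t in atTop, ∀ i ∈ L, trustedNbrs G a t i = L.filter (G.Adj i))
    (e : V → V → ℕ → ℝ) (v : V → V → ℕ → EuclideanSpace ℝ (Fin d))
    {x₀ : V → EuclideanSpace ℝ (Fin d)} (hx₀ : ∀ i ∈ L, x₀ i ∈ X) {i : V} (hi : i ∈ L) :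
    Tendsto (fun t => iterate G L X f γ T₀ a e v x₀ t i) atTop (𝓝 xs) := by
  obtain ⟨T₁, hT₁⟩ := eventually_atTop.1 hN
  have : Nonempty L := ⟨⟨i, hi⟩⟩
  have hbound : ∀ j : L, ∃ B, ∀ z ∈ X, ‖gradient (f j) z‖ ≤ B := fun j =>
    hX.exists_bound_of_continuousOn (hf_cont j j.2).continuousOn
  choose B hB using hbound
  have hBsum : ∀ j : L, ∀ z ∈ X, ‖gradient (f j) z‖ ≤ ∑ k : L, |B k| := fun j z hz =>
    (hB j z hz).trans ((le_abs_self _).trans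
      (Finset.single_le_sum (f := fun k => |B k|) (fun _ _ => abs_nonneg _) (Finset.mem_univ j)))
  -- Shifting by `T₁ + T₀` puts time past both thresholds and turns the delayed stepsize into `γ (t
  -- + T₁)`.
  rw [← tendsto_add_atTop_iff_nat (T₁ + T₀)]
  have hηsum : Tendsto (fun n => ∑ t ∈ Finset.range n, γ (t + T₁)) atTop atTop := by
    have h1 := tendsto_atTop_add_const_left _ (-∑ t ∈ Finset.range T₁, γ t)
      (hγsum.comp (tendsto_add_atTop_nat T₁))
    refine h1.congr fun n => ?_
    rw [Function.comp_apply, add_comm n, Finset.sum_range_add]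
    simp [add_comm]
  refine tendsto_of_distributed_gradient (ι := L) (w := legitWeight G L)
    (F := fun j => f j) (g := fun j => gradient (f j)) (η := fun t => γ (t + T₁))
    (x := fun t j => iterate G L X f γ T₀ a e v x₀ (t + (T₁ + T₀)) j)
    (legitWeight_nonneg G L) (legitWeight_comm G L) (sum_legitWeight G L)
    (half_le_legitWeight_self G L) (reflTransGen_legitWeight hconn) hX hconv hm
    (fun j y z => add_inner_gradient_le_of_strongConvexOn (hf_strong j j.2) (hf_diff j j.2 y) z)
    hBsum (fun t => hγ0 _) (hγ.comp (tendsto_add_atTop_nat T₁)) hηsum hxs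
    (fun z hz => ?_) (fun t j => iterate_mem hX ⟨xs, hxs⟩ f γ T₀ a e v hx₀ _ j.2)
    (fun t j => ?_) ⟨i, hi⟩
  · rw [Finset.sum_coe_sort L (fun j => f j xs), Finset.sum_coe_sort L (fun j => f j z)]
    exact hmin hz
  · rw [show t + 1 + (T₁ + T₀) = t + (T₁ + T₀) + 1 by ring, iterate]
    simp only
    rw [mix_eq (by lia) (hT₁ _ (by lia)), delayedStep, if_pos (by lia),
      show t + (T₁ + T₀) - T₀ = t + T₁ by lia]

theorem strictConvexOn_avgObjective {L : Finset V} (hL : L.Nonempty)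
    {X : Set (EuclideanSpace ℝ (Fin d))} (hX : Convex ℝ X)
    {f : V → EuclideanSpace ℝ (Fin d) → ℝ} (hf : ∀ i ∈ L, StrictConvexOn ℝ Set.univ (f i)) :
    StrictConvexOn ℝ X (avgObjective L f) := by
  refine ⟨hX, fun x _ y _ hxy p q hp hq hpq => ?_⟩
  have hc : 0 < 1 / (L.card : ℝ) := by
    have := hL.card_pos
    positivity
  have h := Finset.sum_lt_sum_of_nonempty hL fun i hi =>
    (hf i hi).2 (Set.mem_univ x) (Set.mem_univ y) hxy hp hq hpq
  simp only [avgObjective, smul_eq_mul] at h ⊢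
  rw [Finset.sum_add_distrib, ← Finset.mul_sum, ← Finset.mul_sum] at h
  calc _ < _ := mul_lt_mul_of_pos_left h hc
    _ = _ := by ring

end Trust

end TrustOpt

/-! ### The almost sure statement. -/

theorem mainTheorem1
    {V : Type*} [Fintype V] {d : ℕ}
    -- the communication graph and the set of legitimate agents (all others are malicious)
    (G : SimpleGraph V) (L : Finset V)
    (hconn : (G.induce (L : Set V)).Connected)
    -- the constraint set
    (X : Set (EuclideanSpace ℝ (Fin d))) (hXcompact : IsCompact X) (hXconvex : Convex ℝ X)
    -- the objective functions
    (f : V → EuclideanSpace ℝ (Fin d) → ℝ) (m : ℝ) (hm : 0 < m) (K : NNReal)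
    (hf_strong : ∀ i ∈ L, StrongConvexOn Set.univ m (f i))
    (hf_diff : ∀ i ∈ L, Differentiable ℝ (f i))
    (hf_lip : ∀ i ∈ L, LipschitzWith K (gradient (f i)))
    -- the stepsizes
    (γ : ℕ → ℝ) (hγ_nonneg : ∀ t, 0 ≤ γ t) (hγ_anti : Antitone γ)
    (hγ_sum : Tendsto (fun n => ∑ t ∈ Finset.range n, γ t) atTop atTop)
    (hγ_sq : Summable fun t => γ t ^ 2)
    -- the trust observations
    {Ω : Type*} [MeasurableSpace Ω] (P : Measure Ω) [IsProbabilityMeasure P]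
    (α : V → V → ℕ → Ω → ℝ) (EL EM : ℝ) (hEL : 0 < EL) (hEM : EM < 0)
    (hα_meas : ∀ i ∈ L, ∀ j, G.Adj i j → ∀ t, Measurable (α i j t))
    (hα_range : ∀ i ∈ L, ∀ j, G.Adj i j → ∀ t, ∀ᵐ ω ∂P, α i j t ω ∈ Set.Icc (0 : ℝ) 1)
    (hα_legit : ∀ i ∈ L, ∀ j ∈ L, G.Adj i j → ∀ t, (∫ ω, α i j t ω ∂P) - 1 / 2 = EL)
    (hα_malicious : ∀ i ∈ L, ∀ j ∉ L, G.Adj i j → ∀ t, (∫ ω, α i j t ω ∂P) - 1 / 2 = EM)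
    (hα_indep : iIndepFun
      (fun (q : {p : V × V // p.1 ∈ L ∧ G.Adj p.1 p.2} × ℕ) => α q.1.1.1 q.1.1.2 q.2) P)
    (hα_ident : ∀ i ∈ L, ∀ j, G.Adj i j → ∀ s t, IdentDistrib (α i j s) (α i j t) P P)
    -- the initial points exist, so that the constraint set is nonempty
    (hXne : X.Nonempty) :
    ∃ xstar ∈ X, IsMinOn (TrustOpt.avgObjective L f) X xstar ∧
      (∀ y ∈ X, IsMinOn (TrustOpt.avgObjective L f) X y → y = xstar) ∧
      ∀ (T₀ : ℕ)
        -- the initial points of the legitimate agents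
        (x₀ : V → Ω → EuclideanSpace ℝ (Fin d)) (_ : ∀ i ∈ L, ∀ ω, x₀ i ω ∈ X)
        -- `v j i t` and `e j i t`: the point and the degree that the malicious agent `j`
        -- sends to its legitimate neighbor `i` at time `t`
        (v : V → V → ℕ → Ω → EuclideanSpace ℝ (Fin d))
        (_ : ∀ j ∉ L, ∀ i ∈ L, G.Adj i j → ∀ t ω, v j i t ω ∈ X)
        (e : V → V → ℕ → Ω → ℝ),
        ∀ i ∈ L, ∀ᵐ ω ∂P, Tendsto
          (fun t => TrustOpt.iterate G L X f γ T₀ (fun k l s => α k l s ω)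
            (fun k l s => e k l s ω) (fun k l s => v k l s ω) (fun k => x₀ k ω) t i)
          atTop (𝓝 xstar) := by
  classical
  have hL : L.Nonempty := by
    obtain ⟨i⟩ := hconn.nonempty
    exact ⟨i, i.2⟩
  have hcard : 0 < 1 / (L.card : ℝ) := by
    have := hL.card_pos
    positivity
  have hcont : ContinuousOn (TrustOpt.avgObjective L f) X := by
    refine Continuous.continuousOn ?_
    exact continuous_const.mul (continuous_finsetSum _ fun i hi => (hf_diff i hi).continuous)
  obtain ⟨xs, hxs, hmin⟩ := hXcompact.exists_isMinOn hXne hcont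
  have hstrict := TrustOpt.strictConvexOn_avgObjective hL hXconvex
    fun i hi => (hf_strong i hi).strictConvexOn hm
  refine ⟨xs, hxs, hmin, fun y hy hymin => hstrict.eq_of_isMinOn hymin hmin hy hxs, ?_⟩
  intro T₀ x₀ hx₀ v _ e i hi
  have hγ : Tendsto γ atTop (𝓝 0) := by
    have h := (Real.continuous_sqrt.tendsto 0).comp hγ_sq.tendsto_atTop_zero
    rw [Real.sqrt_zero] at h
    exact h.congr fun t => Real.sqrt_sq (hγ_nonneg t)
  have hminsum : IsMinOn (fun z => ∑ j ∈ L, f j z) X xs := fun z hz =>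
    le_of_mul_le_mul_left (hmin hz) hcard
  -- The exceptional null set depends only on the trust observations, so initial points and
  -- malicious inputs may depend on `ω` arbitrarily.
  have htrust : ∀ᵐ ω ∂P, ∀ k ∈ L, ∀ l, G.Adj k l →
      Tendsto (fun n : ℕ => TrustOpt.trustSum (fun t => α k l t ω) n / n) atTop
        (𝓝 (if l ∈ L then EL else EM)) := by
    refine ae_all_iff.2 fun k => ?_
    by_cases hk : k ∈ L
    swap
    · exact Eventually.of_forall fun ω h => absurd h hk
    refine (ae_all_iff.2 fun l => ?_).mono fun ω h _ => h
    by_cases hkl : G.Adj k l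
    swap
    · exact Eventually.of_forall fun ω h => absurd h hkl
    -- Joint independence restricts to one edge along the injection `t ↦ ((k, l), t)`.
    have hindep : iIndepFun (fun t => α k l t) P :=
      hα_indep.precomp (g := fun t : ℕ =>
        ((⟨(k, l), hk, hkl⟩, t) : {p : V × V // p.1 ∈ L ∧ G.Adj p.1 p.2} × ℕ))
        fun s t hst => (Prod.mk.inj hst).2
    have hmean : (∫ ω, α k l 0 ω ∂P) - 1 / 2 = if l ∈ L then EL else EM := by
      split_ifs with hl
      · exact hα_legit k hk l hl hkl 0
      · exact hα_malicious k hk l hl hkl 0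
    exact (TrustOpt.ae_tendsto_trustSum_div (hα_meas k hk l hkl 0).aemeasurable
      (hα_range k hk l hkl 0) hmean hindep fun t => hα_ident k hk l hkl t 0).mono fun ω h _ => h
  filter_upwards [htrust] with ω hω
  exact TrustOpt.tendsto_iterate hconn hXcompact hXconvex hm hf_strong hf_diff
    (fun j hj => (hf_lip j hj).continuous) hγ_nonneg hγ hγ_sum hxs hminsum
    (TrustOpt.eventually_trustedNbrs_eq hEL hEM hω) _ _ (fun j hj => hx₀ j hj ω) hi
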